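/- A graph here is a finite looped simple graph: a set $V(G)$ of vertices in which each vertex may or may not carry one loop, and each two distinct vertices may or may not be joined by one edge. The open neighborhood is $N_G(v)=\{w\ne v : vw\in E(G)\}$; the degree of $v$ is $|N_G(v)|$, plus $2$ if $v$ is looped. The loop complement of $G$ at $v$ reverses the loop status of $v$; the simple local complement of $G$ at $v$ reverses all adjacencies between distinct elements of $N_G(v)$; the non-simple local complement at $v$ does this and also reverses the loop status of every element of $N_G(v)$. Two graphs on the same vertex set are locally equivalent if one is obtained from the other by a finite sequence of these three operations. Let $A(G)$ be the $V(G)\times V(G)$ adjacency matrix over $GF(2)$ (with diagonal entry $1$ exactly at looped vertices), and let $M[IAS(G)]$ be the binary matroid represented by the columns of $IAS(G)=\begin{pmatrix} I & A(G) & A(G)+I\end{pmatrix}$; its $3n$ elements are grouped into the vertex triples consisting of the $v$ columns of $I$, $A(G)$ and $A(G)+I$, for $v\in V(G)$. A transversal is a set of elements that meets every vertex triple exactly once, and a transverse circuit is a circuit of the restriction of $M[IAS(G)]$ to a transversal. For a matroid $M$ with ground set $W$ and rank function $r$, and a positive integer $k$, a vertical $k$-separation is a set $S\subseteq W$ with $r(S)+r(W-S)-r(M)<k$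 and $r(S),r(W-S)\ge k$; $\kappa(M)$ is the minimum of $r(M)$ and all $k$ for which $M$ has a vertical $k$-separation; and $M$ is vertically $j$-connected if $2\le j\le\kappa(M)$. **Corollary.** Let $G$ be a graph with $n\ge 7$ vertices. Then: 1. $G$ is locally equivalent to a graph with a vertex of degree $<\frac{n-1}{2}$; 2. $M[IAS(G)]$ is not vertically $n$-connected; 3. $M[IAS(G)]$ has a transverse circuit of size $\le\frac n2$. -/

import Mathlib

/-- A looped simple graph on the vertex set `V`: `G.Edge v w` says that there is an edge whose set of
ends is `{v, w}`, so `G.Edge v v` says that `v` is looped. -/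
@[ext]
structure LoopedGraph (V : Type*) where
  Edge : V → V → Prop
  symm : ∀ v w, Edge v w → Edge w v

namespace LoopedGraph

variable {V : Type*}

/-- The open neighborhood `N_G(v)`; no vertex is its own neighbor, looped or not. -/
def neighbors (G : LoopedGraph V) (v : V) : Set V := {w | w ≠ v ∧ G.Edge v w}

open Classical in
/-- The degree of a vertex; a loop counts twice. -/
noncomputable def degree (G : LoopedGraph V) (v : V) : ℕ :=
  (G.neighbors v).ncard + if G.Edge v v then 2 else 0

/-- Reverse the loop status of every vertex in `X`. -/
def loopComplementOn (G : LoopedGraph V) (X : Set V) : LoopedGraph V where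
  Edge a b := Xor (G.Edge a b) (a = b ∧ a ∈ X)
  symm a b h := by
    have := G.symm a b
    have := G.symm b a
    by_cases hab : a = b
    · subst hab; exact h
    · simp only [Xor, hab, Ne.symm hab] at h ⊢
      tauto

/-- The loop complement of `G` with respect to `v`. -/
def loopComplement (G : LoopedGraph V) (v : V) : LoopedGraph V := G.loopComplementOn {v}

/-- The simple local complement of `G` with respect to `v`: reverse all adjacencies between distinct
neighbors of `v`. -/
def simpleLocalComplement (G : LoopedGraph V) (v : V) : LoopedGraph V where
  Edge a b := Xor (G.Edge a b) (a ≠ b ∧ a ∈ G.neighbors v ∧ b ∈ G.neighbors v)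
  symm a b h := by
    have := G.symm a b
    have := G.symm b a
    have : a ≠ b ↔ b ≠ a := ne_comm
    simp only [Xor] at h ⊢
    tauto

/-- The non-simple local complement of `G` with respect to `v`: the simple local complement, followed
by loop complementations at all neighbors of `v`. -/
def nonSimpleLocalComplement (G : LoopedGraph V) (v : V) : LoopedGraph V :=
  (G.simpleLocalComplement v).loopComplementOn (G.neighbors v)

/-- `H` is obtained from `G` by one local complementation or loop complementation. -/
inductive LocalStep (G : LoopedGraph V) : LoopedGraph V → Prop
  | loop (v : V) : LocalStep G (G.loopComplement v)
  | simple (v : V) : LocalStep G (G.simpleLocalComplement v)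
  | nonSimple (v : V) : LocalStep G (G.nonSimpleLocalComplement v)

/-- `H` is obtained from `G` by a finite sequence of local complementations and loop
complementations. Each step is an involution, so this is a symmetric relation. -/
def LocallyEquivalent (G H : LoopedGraph V) : Prop := Relation.ReflTransGen LocalStep G H

end LoopedGraph

/-- The matroid represented by a matrix: its elements are the (indices of) columns, and a set is
independent when the corresponding family of columns is linearly independent. -/
def Matrix.columnMatroid {m E F : Type*} [Finite E] [Field F] (A : Matrix m E F) : Matroid E :=
  (IndepMatroid.ofFinite (E := Set.univ) Set.finite_univ
    (fun I => LinearIndepOn F A.col I)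
    (linearIndepOn_empty F A.col)
    (fun _ _ hJ hIJ => hJ.mono hIJ)
    (by
      intro I J hI hJ hlt
      by_contra! hcon
      have hspan : ∀ e ∈ J, A.col e ∈ Submodule.span F (A.col '' I) := by
        intro e he
        by_cases heI : e ∈ I
        · exact Submodule.subset_span (Set.mem_image_of_mem _ heI)
        · by_contra hne
          exact hcon e he heI (hI.insert hne)
      have hfin : (A.col '' I).Finite := Set.toFinite _
      have : FiniteDimensional F (Submodule.span F (A.col '' I)) :=
        FiniteDimensional.span_of_finite F hfin
      have hle : Submodule.span F (A.col '' J) ≤ Submodule.span F (A.col '' I) := by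
        rw [Submodule.span_le]
        rintro _ ⟨e, he, rfl⟩
        exact hspan e he
      have hrank : ∀ K : Set E, LinearIndepOn F A.col K →
          Module.finrank F (Submodule.span F (A.col '' K)) = K.ncard := by
        intro K hK
        have : Fintype K := Fintype.ofFinite K
        have h := finrank_span_eq_card (R := F) (b := fun x : K => A.col x) hK
        rw [show Set.range (fun x : K => A.col x) = A.col '' K by
          ext y; simp] at h
        rw [h, ← Nat.card_eq_fintype_card, Nat.card_coe_set_eq]
      have := Submodule.finrank_mono hle
      rw [hrank I hI, hrank J hJ] at this
      omega)
    (fun _ _ => Set.subset_univ _)).matroid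

namespace Matroid

variable {α : Type*}

/-- The rank function of a finite matroid, as a natural number. -/
noncomputable def natRk (M : Matroid α) [M.Finite] (S : Set α) : ℕ := (M.eRk S).toNat

/-- The connectivity function `λ(S) = r(S) + r(W - S) - r(M)`. -/
noncomputable def connectivityFunction (M : Matroid α) [M.Finite] (S : Set α) : ℤ :=
  (M.natRk S : ℤ) + (M.natRk (M.E \ S) : ℤ) - (M.natRk M.E : ℤ)

/-- `S` is a vertical `k`-separation of `M`. -/
def IsVerticalSeparation (M : Matroid α) [M.Finite] (k : ℕ) (S : Set α) : Prop :=
  1 ≤ k ∧ S ⊆ M.E ∧ M.connectivityFunction S < (k : ℤ) ∧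
    k ≤ M.natRk S ∧ k ≤ M.natRk (M.E \ S)

/-- The vertical connectivity `κ(M)`, the minimum of a nonempty set of natural numbers. -/
noncomputable def verticalConnectivity (M : Matroid α) [M.Finite] : ℕ :=
  sInf ({k | ∃ S, M.IsVerticalSeparation k S} ∪ {M.natRk M.E})

/-- `M` is vertically `j`-connected, where `2 ≤ j ≤ κ(M)`. -/
def IsVerticallyConnected (M : Matroid α) [M.Finite] (j : ℕ) : Prop :=
  2 ≤ j ∧ j ≤ M.verticalConnectivity

end Matroid

namespace LoopedGraph

variable {V : Type*}

open Classical in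
/-- The adjacency matrix `A(G)` over `GF(2)`; looped vertices have diagonal entry `1`. -/
noncomputable def adjMatrix (G : LoopedGraph V) : Matrix V V (ZMod 2) :=
  Matrix.of fun v w => if G.Edge v w then 1 else 0

/-- The index set of the columns of `(I | A | A + I)`. -/
abbrev Column (V : Type*) := V ⊕ (V ⊕ V)

/-- The element `φ(v)`, the `v` column of `I`. -/
def phi (v : V) : Column V := Sum.inl v

/-- The element `χ(v)`, the `v` column of `A(G)`. -/
def chi (v : V) : Column V := Sum.inr (Sum.inl v)

/-- The element `ψ(v)`, the `v` column of `A(G) + I`. -/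
def psi (v : V) : Column V := Sum.inr (Sum.inr v)

open Classical in
/-- The matrix `IAS(G) = (I | A(G) | A(G) + I)`. -/
noncomputable def IAS (G : LoopedGraph V) : Matrix V (Column V) (ZMod 2) :=
  Matrix.fromCols 1 (Matrix.fromCols G.adjMatrix (G.adjMatrix + 1))

/-- The isotropic matroid `M[IAS(G)]`. -/
noncomputable def isotropicMatroid [Finite V] (G : LoopedGraph V) : Matroid (Column V) :=
  G.IAS.columnMatroid

/-- The vertex triple of `v`. -/
def vertexTriple (v : V) : Set (Column V) := {phi v, chi v, psi v}

/-- A transversal meets every vertex triple precisely once. -/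
def IsTransversal (T : Set (Column V)) : Prop := ∀ v, (T ∩ vertexTriple v).ncard = 1

/-- A transverse circuit of `G` is a circuit of the restriction of the isotropic matroid to a
transversal. -/
def IsTransverseCircuit [Finite V] (G : LoopedGraph V) (C : Set (Column V)) : Prop :=
  ∃ T, IsTransversal T ∧ (G.isotropicMatroid.restrict T).IsCircuit C

end LoopedGraph

/-!
The words `(x, A x)`, with `A` the adjacency matrix, form a self-dual code for the symplectic form
on pairs of bits. A nonzero word of weight at most `n / 2` gives all three conclusions. Its columns
in `IAS(G)` sum to zero, so they contain a transverse circuit. It is orthogonal to all columns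
outside its support, and by duality the complement of its support contains another nonzero word,
orthogonal to the columns inside, so its support induces a vertical separation. Loop complements
and local complements act on the pair of bits at a single vertex, and they can be used to shrink
the set where `x` is nonzero until a closed neighborhood lies inside the support of the word.

Suppose that there is no such light word. By duality the number of words supported in a set `S`
is then `2 ^ (2|S| - n)`, or `1` when `2|S| ≤ n`, so inclusion-exclusion computes `∑ (-1) ^ wt` over
these words from `n` and `|S|` alone. But `(-1) ^ wt` is a character, so this sum is zero or the
number of words. Taking `|S| = ⌊n / 2⌋ + 2` leaves only `n = 11`, which `|S| = 9` excludes.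
-/

section Code

open Finset Matrix

variable {V F : Type*} [Fintype V] [Field F]

/-- The words supported in `S` of the code `{(x, A x)}`, whose words have a pair of entries
`(x v, (A x) v)` at each position `v`; a word is encoded by its first half `x`. -/
def wordsIn (A : Matrix V V F) (S : Finset V) : Submodule F (V → F) where
  carrier := {x | ∀ v ∉ S, x v = 0 ∧ (A *ᵥ x) v = 0}
  add_mem' hx hy v hv := by simp [mulVec_add, hx v hv, hy v hv]
  zero_mem' v _ := by simp
  smul_mem' c x hx v hv := by simp [mulVec_smul, hx v hv]

theorem mulVec_extend_zero (A : Matrix V V F) (S : Finset V) (y : S → F) :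
    A *ᵥ Function.extend (↑) y 0 = A.submatrix id (↑) *ᵥ y := by
  ext v
  simp only [mulVec, dotProduct, submatrix_apply, id_eq]
  rw [← Finset.sum_subset (Finset.subset_univ S) fun w _ hw => ?_, ← Finset.sum_coe_sort S]
  · exact Finset.sum_congr rfl fun w _ => by rw [Subtype.val_injective.extend_apply]
  · rw [Function.extend_apply' _ _ _ fun ⟨a, ha⟩ => hw (ha ▸ a.2), Pi.zero_apply, mul_zero]

theorem wordsIn_eq_map_ker [DecidableEq V] (A : Matrix V V F) (S : Finset V) :
    (A.submatrix ((↑) : ↥Sᶜ → V) ((↑) : S → V)).mulVecLin.ker.map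
      (Function.ExtendByZero.linearMap F ((↑) : S → V)) = wordsIn A S := by
  ext x
  constructor
  · rintro ⟨y, hy, rfl⟩ v hv
    refine ⟨Function.extend_apply' _ _ _ fun ⟨a, ha⟩ => hv (ha ▸ a.2), ?_⟩
    exact (congrFun (mulVec_extend_zero A S y) v).trans (congrFun hy ⟨v, mem_compl.2 hv⟩)
  · intro hx
    have hext : Function.extend ((↑) : S → V) (fun v => x v) 0 = x := by
      ext v
      by_cases hv : v ∈ S
      · exact Subtype.val_injective.extend_apply (fun v : S => x v) 0 ⟨v, hv⟩
      · rw [Function.extend_apply' _ _ _ fun ⟨a, ha⟩ => hv (ha ▸ a.2), (hx v hv).1, Pi.zero_apply]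
    refine ⟨fun v => x v, ?_, hext⟩
    ext v
    have hv := (hx v (mem_compl.1 v.2)).2
    rwa [← hext, mulVec_extend_zero] at hv

theorem finrank_wordsIn_add_rank [DecidableEq V] (A : Matrix V V F) (S : Finset V) :
    Module.finrank F (wordsIn A S) + (A.submatrix ((↑) : ↥Sᶜ → V) ((↑) : S → V)).rank = #S := by
  rw [← wordsIn_eq_map_ker, ← (Submodule.equivMapOfInjective _
    (Function.extend_injective Subtype.val_injective _) _).finrank_eq, add_comm, rank,
    LinearMap.finrank_range_add_finrank_ker, Module.finrank_fintype_fun_eq_card,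
    Fintype.card_coe]

theorem finrank_wordsIn_add_card [DecidableEq V] {A : Matrix V V F} (hA : A.IsSymm)
    (S : Finset V) :
    Module.finrank F (wordsIn A S) + Fintype.card V =
      Module.finrank F (wordsIn A Sᶜ) + 2 * #S := by
  have hS := finrank_wordsIn_add_rank A S
  have hSc := finrank_wordsIn_add_rank A Sᶜ
  rw [compl_compl, ← rank_transpose, transpose_submatrix, hA.eq] at hSc
  have := Finset.card_add_card_compl S
  omega

variable [DecidableEq F]

/-- The support of the word `(x, A x)`: the positions at which it is not `(0, 0)`. -/
def wordSupport (A : Matrix V V F) (x : V → F) : Finset V := {v | x v ≠ 0 ∨ (A *ᵥ x) v ≠ 0}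

theorem notMem_wordSupport {A : Matrix V V F} {x : V → F} {v : V} :
    v ∉ wordSupport A x ↔ x v = 0 ∧ (A *ᵥ x) v = 0 := by
  simp [wordSupport]

theorem mem_wordsIn {A : Matrix V V F} {S : Finset V} {x : V → F} :
    x ∈ wordsIn A S ↔ wordSupport A x ⊆ S := by
  change (∀ v ∉ S, x v = 0 ∧ (A *ᵥ x) v = 0) ↔ _
  simp only [← notMem_wordSupport, Finset.subset_iff, not_imp_not]

theorem wordSupport_nonempty {A : Matrix V V F} {x : V → F} :
    (wordSupport A x).Nonempty ↔ x ≠ 0 := by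
  rw [← not_iff_not, not_nonempty_iff_eq_empty, not_not]
  refine ⟨fun h => funext fun v => (notMem_wordSupport.1 (h ▸ notMem_empty v)).1, ?_⟩
  rintro rfl
  simp [wordSupport]

theorem exists_wordSupport_subset_compl [DecidableEq V] {A : Matrix V V F} (hA : A.IsSymm)
    {x : V → F} (hx : x ≠ 0) (hlight : 2 * #(wordSupport A x) ≤ Fintype.card V) :
    ∃ y ≠ 0, wordSupport A y ⊆ (wordSupport A x)ᶜ := by
  have hne : wordsIn A (wordSupport A x) ≠ ⊥ :=
    (Submodule.ne_bot_iff _).2 ⟨x, mem_wordsIn.2 subset_rfl, hx⟩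
  have hpos := Submodule.one_le_finrank_iff.2 hne
  have hdim := finrank_wordsIn_add_card hA (wordSupport A x)
  obtain ⟨y, hy, hy0⟩ := (Submodule.ne_bot_iff _).1 <| Submodule.one_le_finrank_iff.1
    (show 1 ≤ Module.finrank F (wordsIn A (wordSupport A x)ᶜ) by omega)
  exact ⟨y, hy0, mem_wordsIn.1 hy⟩

variable [Fintype F] [DecidableEq V]

theorem card_wordSupport_subset (A : Matrix V V F) (S : Finset V) :
    #{x | wordSupport A x ⊆ S} = Fintype.card F ^ Module.finrank F (wordsIn A S) := by
  classical
  simp only [← mem_wordsIn]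
  rw [← Module.card_eq_pow_finrank, Fintype.card_subtype]

theorem card_wordSupport_subset_of_forall_lt {A : Matrix V V F} (hA : A.IsSymm)
    (hheavy : ∀ x ≠ 0, Fintype.card V < 2 * #(wordSupport A x)) (S : Finset V) :
    #{x | wordSupport A x ⊆ S} = Fintype.card F ^ (2 * #S - Fintype.card V) := by
  have hbot : ∀ T : Finset V, 2 * #T ≤ Fintype.card V → Module.finrank F (wordsIn A T) = 0 := by
    intro T hT
    rw [Submodule.finrank_eq_zero, Submodule.eq_bot_iff]
    intro x hx
    by_contra hx0
    have := hheavy x hx0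
    have := card_le_card (mem_wordsIn.1 hx)
    omega
  rw [card_wordSupport_subset]
  congr 1
  have hdim := finrank_wordsIn_add_card hA S
  have hcard := card_add_card_compl S
  rcases le_total (2 * #S) (Fintype.card V) with h | h
  · rw [hbot S h]
    omega
  · rw [hbot Sᶜ (by omega)] at hdim
    omega

theorem sum_Icc_pow_mul_pow {α R : Type*} [DecidableEq α] [CommSemiring R] (a b : R)
    {S T : Finset α} (h : T ⊆ S) :
    ∑ U ∈ Icc T S, a ^ #U * b ^ (#S - #U) = a ^ #T * (a + b) ^ (#S - #T) := by
  have hdisj : ∀ U ⊆ S \ T, Disjoint T U := fun U hU => disjoint_sdiff.mono_right hU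
  rw [Icc_eq_image_powerset h, sum_image, ← card_sdiff_of_subset h, ← sum_pow_mul_eq_add_pow,
    mul_sum]
  · refine sum_congr rfl fun U hU => ?_
    rw [card_union_of_disjoint (hdisj U (mem_powerset.1 hU)), pow_add, mul_assoc,
      card_sdiff_of_subset h, Nat.sub_add_eq]
  · intro U hU U' hU' (hUU' : T ∪ U = T ∪ U')
    rw [← union_sdiff_cancel_left (hdisj U (mem_powerset.1 hU)), hUU',
      union_sdiff_cancel_left (hdisj U' (mem_powerset.1 hU'))]

theorem sum_neg_one_pow_card_wordSupport (A : Matrix V V F) (S : Finset V) :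
    ∑ x with wordSupport A x ⊆ S, (-1 : ℤ) ^ #(wordSupport A x) =
      ∑ U ∈ S.powerset, (-1 : ℤ) ^ #U * 2 ^ (#S - #U) * #{x | wordSupport A x ⊆ U} := by
  calc
    _ = ∑ x with wordSupport A x ⊆ S, ∑ U ∈ Icc (wordSupport A x) S,
          (-1 : ℤ) ^ #U * 2 ^ (#S - #U) := by
      refine sum_congr rfl fun x hx => ?_
      rw [sum_Icc_pow_mul_pow _ _ (mem_filter.1 hx).2]
      norm_num
    _ = ∑ U ∈ S.powerset, ∑ x with wordSupport A x ⊆ U, (-1 : ℤ) ^ #U * 2 ^ (#S - #U) := by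
      refine sum_comm' fun x U => ?_
      simp only [mem_filter, mem_univ, true_and, mem_Icc, mem_powerset]
      exact ⟨And.right, fun h => ⟨h.1.trans h.2, h⟩⟩
    _ = _ := by simp only [sum_const, nsmul_eq_mul, mul_comm]

end Code

section Parity

open Finset Matrix

variable {V : Type*} [Fintype V]

theorem natCast_card_wordSupport (A : Matrix V V (ZMod 2)) (x : V → ZMod 2) :
    (#(wordSupport A x) : ZMod 2) = ∑ v, x v + ∑ v, (A *ᵥ x) v + x ⬝ᵥ A *ᵥ x := by
  have hbits : ∀ a b : ZMod 2, ((if a ≠ 0 ∨ b ≠ 0 then 1 else 0 : ℕ) : ZMod 2) = a + b + a * b := by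
    decide
  simp only [wordSupport, card_filter, Nat.cast_sum, hbits, sum_add_distrib, dotProduct]

theorem natCast_card_wordSupport_add {A : Matrix V V (ZMod 2)} (hA : A.IsSymm)
    (x y : V → ZMod 2) :
    (#(wordSupport A (x + y)) : ZMod 2) = #(wordSupport A x) + #(wordSupport A y) := by
  have hcross : x ⬝ᵥ A *ᵥ y = y ⬝ᵥ A *ᵥ x := by
    rw [dotProduct_mulVec, ← mulVec_transpose, hA.eq, dotProduct_comm]
  simp only [natCast_card_wordSupport, mulVec_add, Pi.add_apply, sum_add_distrib, add_dotProduct,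
    dotProduct_add, hcross]
  linear_combination (y ⬝ᵥ A *ᵥ x) * CharTwo.two_eq_zero (R := ZMod 2)

/-- The character `(-1) ^ wt` of the additive group of words. -/
def weightSign {A : Matrix V V (ZMod 2)} (hA : A.IsSymm) : AddChar (V → ZMod 2) ℤ where
  toFun x := (-1) ^ #(wordSupport A x)
  map_zero_eq_one' := by simp [wordSupport]
  map_add_eq_mul' x y := by
    rw [← pow_add, neg_one_pow_eq_pow_mod_two, neg_one_pow_eq_pow_mod_two (_ + _)]
    have h := natCast_card_wordSupport_add hA x y
    rw [← Nat.cast_add, ZMod.natCast_eq_natCast_iff'] at h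
    rw [h]

theorem sum_neg_one_pow_card_wordSupport_eq_zero_or [DecidableEq V]
    {A : Matrix V V (ZMod 2)} (hA : A.IsSymm) (S : Finset V) :
    ∑ x with wordSupport A x ⊆ S, (-1 : ℤ) ^ #(wordSupport A x) = 0 ∨
      ∑ x with wordSupport A x ⊆ S, (-1 : ℤ) ^ #(wordSupport A x) = #{x | wordSupport A x ⊆ S} := by
  classical
  have h := ((weightSign hA).compAddMonoidHom (wordsIn A S).subtype.toAddMonoidHom).sum_eq_ite
  have hsum : ∑ x with wordSupport A x ⊆ S, (-1 : ℤ) ^ #(wordSupport A x) =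
      ∑ x : wordsIn A S, (-1 : ℤ) ^ #(wordSupport A x.1) :=
    sum_subtype _ (by simp [mem_wordsIn]) _
  have hcard : Fintype.card (wordsIn A S) = #{x | wordSupport A x ⊆ S} := by
    simp only [← mem_wordsIn, Fintype.card_subtype]
  rw [hsum, ← hcard]
  split_ifs at h
  · exact .inr h
  · exact .inl h

/-- The value of `∑ (-1) ^ wt` over the words supported in a set of `s` positions, for a symmetric
`n × n` matrix over `𝔽₂` none of whose nonzero words has weight at most `n / 2`. The truncated
subtraction `2 * k - n` is intended. -/
def heavySignSum (n s : ℕ) : ℤ :=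
  ∑ k ∈ range (s + 1), s.choose k * ((-1 : ℤ) ^ k * 2 ^ (s - k) * 2 ^ (2 * k - n))

theorem heavySignSum_eq_zero_or {A : Matrix V V (ZMod 2)} (hA : A.IsSymm)
    (hheavy : ∀ x ≠ 0, Fintype.card V < 2 * #(wordSupport A x)) {s : ℕ} (hs : s ≤ Fintype.card V) :
    heavySignSum (Fintype.card V) s = 0 ∨
      heavySignSum (Fintype.card V) s = 2 ^ (2 * s - Fintype.card V) := by
  classical
  obtain ⟨S, -, rfl⟩ := exists_subset_card_eq (s := (univ : Finset V)) (n := s) (by simpa)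
  have h := sum_neg_one_pow_card_wordSupport_eq_zero_or hA S
  simp only [sum_neg_one_pow_card_wordSupport, card_wordSupport_subset_of_forall_lt hA hheavy,
    ZMod.card, Nat.cast_pow, Nat.cast_ofNat] at h
  rw [sum_powerset_apply_card
    (fun k => (-1 : ℤ) ^ k * 2 ^ (#S - k) * 2 ^ (2 * k - Fintype.card V))] at h
  simpa only [heavySignSum, nsmul_eq_mul] using h

theorem heavySignSum_eq_one_add_sum (n s : ℕ) :
    heavySignSum n s = 1 + ∑ k ∈ range (s + 1),
      s.choose k * ((-1 : ℤ) ^ k * 2 ^ (s - k) * (2 ^ (2 * k - n) - 1)) := by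
  have hbinom : ∑ k ∈ range (s + 1), (-1 : ℤ) ^ k * 2 ^ (s - k) * s.choose k = 1 := by
    rw [← add_pow]
    norm_num
  rw [heavySignSum, ← sub_eq_iff_eq_add, ← sum_sub_distrib]
  exact (sum_congr rfl fun k _ => by ring).trans hbinom

theorem heavySignSum_two_mul_add (m a : ℕ) :
    heavySignSum (2 * m + a) (m + 2) =
      1 + (-1) ^ m * (2 ^ (4 - a) - 1 - 2 * (m + 2) * (2 ^ (2 - a) - 1)) := by
  have hlow : ∀ k ∈ range (m + 1), 2 * k - (2 * m + a) = 0 := fun k hk => by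
    have := mem_range.1 hk
    omega
  rw [heavySignSum_eq_one_add_sum, sum_range_succ, sum_range_succ,
    sum_eq_zero fun k hk => by simp [hlow k hk],
    show 2 * (m + 1) - (2 * m + a) = 2 - a by omega,
    show 2 * (m + 2) - (2 * m + a) = 4 - a by omega, Nat.choose_succ_self_right, Nat.choose_self,
    show m + 2 - (m + 1) = 1 by omega]
  norm_num
  ring

theorem exists_two_mul_card_wordSupport_le {A : Matrix V V (ZMod 2)} (hA : A.IsSymm)
    (hn : Fintype.card V = 4 ∨ 7 ≤ Fintype.card V) :
    ∃ x ≠ 0, 2 * #(wordSupport A x) ≤ Fintype.card V := by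
  by_contra! hheavy
  obtain ⟨m, a, ha, hcard⟩ : ∃ m a, a < 2 ∧ Fintype.card V = 2 * m + a :=
    ⟨_, _, Nat.mod_lt _ two_pos, (Nat.div_add_mod _ 2).symm⟩
  have hsign := heavySignSum_eq_zero_or hA hheavy (s := m + 2) (by omega)
  rw [hcard, heavySignSum_two_mul_add, show 2 * (m + 2) - (2 * m + a) = 4 - a by omega] at hsign
  have heleven : Fintype.card V = 11 := by
    interval_cases a <;> rcases neg_one_pow_eq_or ℤ m with h | h <;> rw [h] at hsign <;> omega
  have hsign' := heavySignSum_eq_zero_or hA hheavy (s := 9) (by omega)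
  rw [heleven] at hsign'
  revert hsign'
  decide

end Parity

section ColumnMatroid

open Matrix

variable {m E F : Type*} [Finite E] [Field F] (A : Matrix m E F)

theorem natRk_columnMatroid (S : Set E) :
    A.columnMatroid.natRk S = Module.finrank F (Submodule.span F (A.col '' S)) := by
  obtain ⟨I, hI⟩ := A.columnMatroid.exists_isBasis S (Set.subset_univ S)
  have hIndep : LinearIndepOn F A.col I := hI.indep
  have hspan : Submodule.span F (A.col '' S) = Submodule.span F (A.col '' I) := by
    refine le_antisymm (Submodule.span_le.2 ?_) (Submodule.span_mono (Set.image_mono hI.subset))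
    rintro _ ⟨e, he, rfl⟩
    by_contra hne
    have hins : A.columnMatroid.Indep (insert e I) := hIndep.insert hne
    exact hne (Submodule.subset_span ⟨e, hI.mem_of_insert_indep he hins, rfl⟩)
  have : Fintype I := Fintype.ofFinite I
  rw [hspan, Set.image_eq_range, finrank_span_eq_card hIndep, Matroid.natRk,
    ← hI.encard_eq_eRk, ← Nat.card_eq_fintype_card, Nat.card_coe_set_eq, Set.ncard_def]

theorem natRk_columnMatroid_lt [Fintype m] {S : Set E} {x : m → F} (hx : x ≠ 0)
    (h : ∀ e ∈ S, x ⬝ᵥ A.col e = 0) : A.columnMatroid.natRk S < Fintype.card m := by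
  rw [natRk_columnMatroid, ← Module.finrank_fintype_fun_eq_card F]
  refine Submodule.finrank_lt fun htop => hx (dotProduct_eq_zero x fun y => ?_)
  have hle : Submodule.span F (A.col '' S) ≤ LinearMap.ker (dotProductBilin F F x) := by
    rw [Submodule.span_le]
    rintro _ ⟨e, he, rfl⟩
    exact h e he
  exact hle (htop ▸ Submodule.mem_top)

end ColumnMatroid

theorem verticalConnectivity_lt_natRk_ground {α : Type*} {M : Matroid α} [M.Finite] {S : Set α}
    (hSE : S ⊆ M.E) (hS : M.natRk S < M.natRk M.E) (hSc : M.natRk (M.E \ S) < M.natRk M.E) :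
    M.verticalConnectivity < M.natRk M.E := by
  have hsub : M.natRk M.E ≤ M.natRk S + M.natRk (M.E \ S) := by
    have h := M.eRk_union_le_eRk_add_eRk S (M.E \ S)
    rw [Set.union_sdiff_cancel hSE] at h
    have hfin (X : Set α) : M.eRk X ≠ ⊤ := (M.isRkFinite_set X).eRk_lt_top.ne
    rw [Matroid.natRk, Matroid.natRk, Matroid.natRk, ← ENat.toNat_add (hfin _) (hfin _)]
    exact ENat.toNat_le_toNat h (by simp [hfin])
  have hsep : M.IsVerticalSeparation (M.natRk S + M.natRk (M.E \ S) - M.natRk M.E + 1) S := by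
    refine ⟨by omega, hSE, ?_, by omega, by omega⟩
    rw [Matroid.connectivityFunction]
    omega
  have : M.verticalConnectivity ≤ _ := Nat.sInf_le (.inl ⟨S, hsep⟩)
  omega

namespace LoopedGraph

open Finset Matrix

variable {V : Type*} (G : LoopedGraph V)

theorem adjMatrix_isSymm : G.adjMatrix.IsSymm := by
  ext v w
  simp only [transpose_apply, adjMatrix, of_apply]
  congr 1
  exact propext ⟨G.symm w v, G.symm v w⟩

section IsotropicMatroid

theorem IAS_col_phi [DecidableEq V] (v : V) : G.IAS.col (phi v) = Pi.single v 1 := by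
  ext u
  simp only [IAS, phi, col_apply, fromCols_apply_inl, one_apply, Pi.single_apply]
  congr

theorem IAS_col_chi (v : V) : G.IAS.col (chi v) = G.adjMatrix.col v := by
  ext u
  simp [IAS, chi]

theorem IAS_col_psi [DecidableEq V] (v : V) :
    G.IAS.col (psi v) = G.adjMatrix.col v + Pi.single v 1 := by
  ext u
  simp only [IAS, psi, col_apply, fromCols_apply_inr, Matrix.add_apply, one_apply, Pi.single_apply,
    Pi.add_apply]
  congr

theorem exists_mem_vertexTriple (e : Column V) : ∃ v, e ∈ vertexTriple v := by
  rcases e with v | v | v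
  exacts [⟨v, .inl rfl⟩, ⟨v, .inr (.inl rfl)⟩, ⟨v, .inr (.inr rfl)⟩]

theorem eq_of_mem_vertexTriple {v w : V} {e : Column V} (hv : e ∈ vertexTriple v)
    (hw : e ∈ vertexTriple w) : v = w := by
  rcases hv with rfl | rfl | rfl <;> rcases hw with h | h | h <;>
    simp only [phi, chi, psi, Sum.inl.injEq, Sum.inr.injEq, Set.mem_singleton_iff,
      reduceCtorEq] at h <;>
    exact h

variable [Fintype V]

theorem natRk_isotropicMatroid_ground :
    G.isotropicMatroid.natRk G.isotropicMatroid.E = Fintype.card V := by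
  classical
  suffices htop : Submodule.span (ZMod 2) (G.IAS.col '' Set.univ) = ⊤ by
    have hrank := natRk_columnMatroid G.IAS Set.univ
    rwa [htop, finrank_top, Module.finrank_fintype_fun_eq_card] at hrank
  rw [eq_top_iff, ← (Pi.basisFun (ZMod 2) V).span_eq, Submodule.span_le]
  rintro _ ⟨v, rfl⟩
  refine Submodule.subset_span ⟨phi v, trivial, ?_⟩
  rw [IAS_col_phi, Pi.basisFun_apply]

theorem dotProduct_IAS_col_eq_zero {x : V → ZMod 2} {v : V}
    (hv : v ∉ wordSupport G.adjMatrix x) {e : Column V} (he : e ∈ vertexTriple v) :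
    x ⬝ᵥ G.IAS.col e = 0 := by
  classical
  obtain ⟨hxv, hzv⟩ := notMem_wordSupport.1 hv
  have hchi : x ⬝ᵥ G.adjMatrix.col v = 0 := by
    rw [← hzv, dotProduct_comm, ← row_transpose, G.adjMatrix_isSymm.eq]
    rfl
  rcases he with rfl | rfl | rfl
  · rw [IAS_col_phi, dotProduct_single, hxv, zero_mul]
  · rw [IAS_col_chi, hchi]
  · rw [IAS_col_psi, dotProduct_add, hchi, dotProduct_single, hxv, zero_mul, zero_add]

/-- The union of the vertex triples of the elements of `D`. -/
def triples (D : Finset V) : Set (Column V) := ⋃ v ∈ D, vertexTriple v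

theorem not_isVerticallyConnected_of_two_mul_card_wordSupport_le {x : V → ZMod 2} (hx : x ≠ 0)
    (hlight : 2 * #(wordSupport G.adjMatrix x) ≤ Fintype.card V) :
    ¬ G.isotropicMatroid.IsVerticallyConnected (Fintype.card V) := by
  classical
  obtain ⟨y, hy, hyx⟩ := exists_wordSupport_subset_compl G.adjMatrix_isSymm hx hlight
  have hground := G.natRk_isotropicMatroid_ground
  have hin : G.isotropicMatroid.natRk (triples (wordSupport G.adjMatrix x)) < Fintype.card V := by
    refine natRk_columnMatroid_lt _ hy fun e he => ?_
    obtain ⟨v, hv, he⟩ := Set.mem_iUnion₂.1 he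
    exact G.dotProduct_IAS_col_eq_zero (fun h => mem_compl.1 (hyx h) hv) he
  have hout : G.isotropicMatroid.natRk
      (G.isotropicMatroid.E \ triples (wordSupport G.adjMatrix x)) < Fintype.card V := by
    refine natRk_columnMatroid_lt _ hx fun e he => ?_
    obtain ⟨v, hv⟩ := exists_mem_vertexTriple e
    exact G.dotProduct_IAS_col_eq_zero (fun h => he.2 (Set.mem_iUnion₂.2 ⟨v, h, hv⟩)) hv
  rintro ⟨-, hκ⟩
  rw [← hground] at hin hout hκ
  exact (verticalConnectivity_lt_natRk_ground (Set.subset_univ _) hin hout).not_ge hκ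

/-- The column at `v` that records the pair of bits `(x v, (A x) v)` of a word. The pair `(0, 0)`
has no column of its own and is sent to `phi v`, like `(0, 1)`. -/
noncomputable def wordColumn (x : V → ZMod 2) (v : V) : Column V :=
  if x v = 0 then phi v else if (G.adjMatrix *ᵥ x) v = 0 then chi v else psi v

theorem wordColumn_mem_vertexTriple (x : V → ZMod 2) (v : V) :
    G.wordColumn x v ∈ vertexTriple v := by
  unfold wordColumn vertexTriple
  split_ifs <;> simp

theorem wordColumn_injective (x : V → ZMod 2) : Function.Injective (G.wordColumn x) :=
  fun v w h => eq_of_mem_vertexTriple (G.wordColumn_mem_vertexTriple x v)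
    (h ▸ G.wordColumn_mem_vertexTriple x w)

theorem isTransversal_range_wordColumn (x : V → ZMod 2) :
    IsTransversal (Set.range (G.wordColumn x)) := by
  intro v
  rw [Set.ncard_eq_one]
  refine ⟨G.wordColumn x v, Set.eq_singleton_iff_unique_mem.2
    ⟨⟨⟨v, rfl⟩, G.wordColumn_mem_vertexTriple x v⟩, ?_⟩⟩
  rintro _ ⟨⟨w, rfl⟩, hw⟩
  rw [eq_of_mem_vertexTriple (G.wordColumn_mem_vertexTriple x w) hw]

theorem IAS_col_wordColumn [DecidableEq V] {x : V → ZMod 2} {v : V}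
    (hv : v ∈ wordSupport G.adjMatrix x) :
    G.IAS.col (G.wordColumn x v) =
      Pi.single v ((G.adjMatrix *ᵥ x) v) + x v • G.adjMatrix.col v := by
  have hbit : ∀ a : ZMod 2, a ≠ 0 → a = 1 := by decide
  unfold wordColumn
  split_ifs with hxv hzv
  · have hzv : (G.adjMatrix *ᵥ x) v ≠ 0 := fun hzv => notMem_wordSupport.2 ⟨hxv, hzv⟩ hv
    rw [IAS_col_phi, hxv, hbit _ hzv, zero_smul, add_zero]
  · rw [IAS_col_chi, hzv, hbit _ hxv, one_smul, Pi.single_zero, zero_add]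
  · rw [IAS_col_psi, hbit _ hxv, hbit _ hzv, one_smul, add_comm]

theorem sum_IAS_col_wordColumn (x : V → ZMod 2) :
    ∑ v ∈ wordSupport G.adjMatrix x, G.IAS.col (G.wordColumn x v) = 0 := by
  classical
  have hcols : ∑ v, x v • G.adjMatrix.col v = G.adjMatrix *ᵥ x := by
    ext u
    simp [mulVec, dotProduct, mul_comm]
  calc
    _ = ∑ v, (Pi.single v ((G.adjMatrix *ᵥ x) v) + x v • G.adjMatrix.col v) := by
      rw [sum_congr rfl fun v hv => G.IAS_col_wordColumn hv]
      refine sum_subset (subset_univ _) fun v _ hv => ?_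
      obtain ⟨hxv, hzv⟩ := notMem_wordSupport.1 hv
      rw [hxv, hzv, Pi.single_zero, zero_smul, add_zero]
    _ = G.adjMatrix *ᵥ x + G.adjMatrix *ᵥ x := by rw [sum_add_distrib, univ_sum_single, hcols]
    _ = 0 := funext fun _ => CharTwo.add_self_eq_zero _

theorem exists_isTransverseCircuit_ncard_le {x : V → ZMod 2} (hx : x ≠ 0) :
    ∃ C, G.IsTransverseCircuit C ∧ C.ncard ≤ #(wordSupport G.adjMatrix x) := by
  have hdep : (G.isotropicMatroid.restrict (Set.range (G.wordColumn x))).Dep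
      (G.wordColumn x '' wordSupport G.adjMatrix x) := by
    refine ⟨fun h => ?_, Set.image_subset_range _ _⟩
    have hindep : LinearIndepOn (ZMod 2) (G.IAS.col ∘ G.wordColumn x)
        (wordSupport G.adjMatrix x : Set V) :=
      LinearIndepOn.comp_of_image (Matroid.restrict_indep_iff.1 h).1
        (G.wordColumn_injective x).injOn
    obtain ⟨v, hv⟩ := wordSupport_nonempty.2 hx
    exact one_ne_zero (linearIndepOn_finset_iff.1 hindep (fun _ => 1)
      (by simpa using G.sum_IAS_col_wordColumn x) v hv)
  obtain ⟨C, hCx, hC⟩ := hdep.exists_isCircuit_subset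
  refine ⟨C, ⟨_, G.isTransversal_range_wordColumn x, hC⟩, ?_⟩
  calc
    C.ncard ≤ (G.wordColumn x '' wordSupport G.adjMatrix x).ncard :=
      Set.ncard_le_ncard hCx (Set.toFinite _)
    _ ≤ (wordSupport G.adjMatrix x : Set V).ncard := Set.ncard_image_le (Set.toFinite _)
    _ = #(wordSupport G.adjMatrix x) := Set.ncard_coe_finset _

end IsotropicMatroid

section LocalEquivalence

theorem adjMatrix_ne_zero {G : LoopedGraph V} {v w : V} : G.adjMatrix v w ≠ 0 ↔ G.Edge v w := by
  simp [adjMatrix]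

theorem adjMatrix_eq_zero {G : LoopedGraph V} {v w : V} : G.adjMatrix v w = 0 ↔ ¬ G.Edge v w := by
  simp [adjMatrix]

theorem loopComplement_edge {v a b : V} :
    (G.loopComplement v).Edge a b ↔ Xor (G.Edge a b) (a = v ∧ b = v) := by
  have hloop : a = b ∧ a ∈ ({v} : Set V) ↔ a = v ∧ b = v := by
    rw [Set.mem_singleton_iff]
    grind
  exact iff_of_eq (congrArg (Xor (G.Edge a b)) (propext hloop))

theorem loopComplement_edge_self {v : V} : (G.loopComplement v).Edge v v ↔ ¬ G.Edge v v := by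
  simp [loopComplement_edge, Xor]

theorem neighbors_loopComplement (v w : V) :
    (G.loopComplement v).neighbors w = G.neighbors w := by
  ext u
  refine and_congr_right fun hu => ?_
  have huw : ¬ (w = v ∧ u = v) := fun h => hu (h.2.trans h.1.symm)
  simp [loopComplement_edge, Xor, huw]

theorem nonSimpleLocalComplement_edge {v a b : V} :
    (G.nonSimpleLocalComplement v).Edge a b ↔
      Xor (G.Edge a b) (a ∈ G.neighbors v ∧ b ∈ G.neighbors v) := by
  simp only [nonSimpleLocalComplement, simpleLocalComplement, loopComplementOn, Xor]
  by_cases hab : a = b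
  · subst hab
    tauto
  · tauto

theorem ite_xor_one_zero (p q : Prop) [Decidable p] [Decidable q] [Decidable (Xor p q)] :
    (if Xor p q then 1 else 0 : ZMod 2) = (if p then 1 else 0) + if q then 1 else 0 := by
  by_cases hp : p <;> by_cases hq : q <;> simp [Xor, hp, hq, CharTwo.add_self_eq_zero]

theorem adjMatrix_loopComplement [DecidableEq V] (v : V) :
    (G.loopComplement v).adjMatrix = G.adjMatrix + Matrix.single v v 1 := by
  classical
  ext a b
  simp only [adjMatrix, of_apply, Matrix.add_apply, single_apply, loopComplement_edge,
    ite_xor_one_zero, eq_comm (a := v)]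

theorem adjMatrix_nonSimpleLocalComplement {v : V} (hv : ¬ G.Edge v v) :
    (G.nonSimpleLocalComplement v).adjMatrix =
      G.adjMatrix + vecMulVec (G.adjMatrix.col v) (G.adjMatrix.col v) := by
  classical
  have hmem : ∀ a, a ∈ G.neighbors v ↔ G.Edge a v := fun a =>
    ⟨fun h => G.symm _ _ h.2, fun h => ⟨fun hav => hv (hav ▸ h), G.symm _ _ h⟩⟩
  ext a b
  simp only [adjMatrix, of_apply, Matrix.add_apply, vecMulVec_apply, col_apply,
    nonSimpleLocalComplement_edge, ite_xor_one_zero, hmem, ite_zero_mul_ite_zero, mul_one]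

variable [Fintype V]

theorem loopComplement_mulVec [DecidableEq V] (v : V) (x : V → ZMod 2) :
    (G.loopComplement v).adjMatrix *ᵥ x = G.adjMatrix *ᵥ x + Pi.single v (x v) := by
  rw [adjMatrix_loopComplement, add_mulVec, single_mulVec, one_mul]
  rfl

theorem nonSimpleLocalComplement_mulVec {v : V} (hv : ¬ G.Edge v v) (x : V → ZMod 2) :
    (G.nonSimpleLocalComplement v).adjMatrix *ᵥ x =
      G.adjMatrix *ᵥ x + (G.adjMatrix *ᵥ x) v • G.adjMatrix.col v := by
  have hdot : G.adjMatrix.col v ⬝ᵥ x = (G.adjMatrix *ᵥ x) v := by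
    rw [← row_transpose, G.adjMatrix_isSymm.eq]
    rfl
  rw [adjMatrix_nonSimpleLocalComplement G hv, add_mulVec, vecMulVec_mulVec, hdot, op_smul_eq_smul]

theorem wordSupport_loopComplement (v : V) (x : V → ZMod 2) :
    wordSupport (G.loopComplement v).adjMatrix x = wordSupport G.adjMatrix x := by
  classical
  ext u
  rw [← not_iff_not, notMem_wordSupport, notMem_wordSupport, loopComplement_mulVec]
  refine and_congr_right fun hxu => ?_
  by_cases huv : u = v
  · subst huv
    simp [hxu]
  · simp [huv]

-- At `v` the pair of bits `(a, b)` becomes `(a + b, b)`; all other pairs are unchanged.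
theorem wordSupport_nonSimpleLocalComplement [DecidableEq V] {v : V} (hv : ¬ G.Edge v v)
    (x : V → ZMod 2) :
    wordSupport (G.nonSimpleLocalComplement v).adjMatrix
      (x + Pi.single v ((G.adjMatrix *ᵥ x) v)) = wordSupport G.adjMatrix x := by
  have hmulVec : (G.nonSimpleLocalComplement v).adjMatrix *ᵥ
      (x + Pi.single v ((G.adjMatrix *ᵥ x) v)) = G.adjMatrix *ᵥ x := by
    have hdiag : G.adjMatrix v v = 0 := adjMatrix_eq_zero.2 hv
    ext u
    simp only [mulVec_add, nonSimpleLocalComplement_mulVec G hv, mulVec_single, Pi.add_apply,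
      Pi.smul_apply, col_apply, hdiag, smul_eq_mul, MulOpposite.smul_eq_mul_unop,
      MulOpposite.unop_op]
    linear_combination
      ((G.adjMatrix *ᵥ x) v * G.adjMatrix u v) * CharTwo.two_eq_zero (R := ZMod 2)
  ext u
  rw [← not_iff_not, notMem_wordSupport, notMem_wordSupport, hmulVec]
  refine and_congr_left fun hzu => ?_
  by_cases huv : u = v
  · subst huv
    simp [hzu]
  · simp [huv]

variable {G}

/-- The word `(x, A x)` of `G` can be carried to a locally equivalent graph, with the same support,
so that its first half gets fewer nonzero entries. -/
def IsReducible (G : LoopedGraph V) (x : V → ZMod 2) : Prop :=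
  ∃ H y, G.LocallyEquivalent H ∧ wordSupport H.adjMatrix y = wordSupport G.adjMatrix x ∧
    #{v | y v ≠ 0} < #{v | x v ≠ 0}

theorem IsReducible.of_loopComplement {v : V} {x : V → ZMod 2}
    (h : (G.loopComplement v).IsReducible x) : G.IsReducible x := by
  obtain ⟨H, y, hGH, hsupp, hlt⟩ := h
  exact ⟨H, y, hGH.head (.loop v), hsupp.trans (G.wordSupport_loopComplement v x), hlt⟩

theorem IsReducible.of_nonSimpleLocalComplement {v : V} {x : V → ZMod 2} (hv : ¬ G.Edge v v)
    (hzv : (G.adjMatrix *ᵥ x) v = 0) (h : (G.nonSimpleLocalComplement v).IsReducible x) :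
    G.IsReducible x := by
  classical
  obtain ⟨H, y, hGH, hsupp, hlt⟩ := h
  have hG := G.wordSupport_nonSimpleLocalComplement hv x
  rw [hzv, Pi.single_zero, add_zero] at hG
  exact ⟨H, y, hGH.head (.nonSimple v), hsupp.trans hG, hlt⟩

theorem isReducible_of_mulVec_ne_zero {v : V} {x : V → ZMod 2} (hv : ¬ G.Edge v v)
    (hxv : x v ≠ 0) (hzv : (G.adjMatrix *ᵥ x) v ≠ 0) : G.IsReducible x := by
  classical
  have hbits : ∀ a b : ZMod 2, a ≠ 0 → b ≠ 0 → a + b = 0 := by decide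
  have hxz : x v + (G.adjMatrix *ᵥ x) v = 0 := hbits _ _ hxv hzv
  refine ⟨_, _, .single (.nonSimple v), G.wordSupport_nonSimpleLocalComplement hv x,
    card_lt_card ⟨fun u hu => ?_, fun h => ?_⟩⟩
  · have huv : u ≠ v := by
      rintro rfl
      simp [hxz] at hu
    simpa [huv] using hu
  · have hv := h (mem_filter.2 ⟨mem_univ v, hxv⟩)
    simp [hxz] at hv

theorem isReducible_of_mulVec_ne_diag {v : V} {x : V → ZMod 2} (hxv : x v ≠ 0)
    (hzv : (G.adjMatrix *ᵥ x) v ≠ G.adjMatrix v v) : G.IsReducible x := by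
  classical
  by_cases hv : G.Edge v v
  · have hbits : ∀ a b c : ZMod 2, a ≠ b → b ≠ 0 → c ≠ 0 → a + c ≠ 0 := by decide
    refine (isReducible_of_mulVec_ne_zero (G := G.loopComplement v) ?_ hxv ?_).of_loopComplement
    · rwa [loopComplement_edge_self, not_not]
    · rw [loopComplement_mulVec, Pi.add_apply, Pi.single_eq_same]
      exact hbits _ _ _ hzv (adjMatrix_ne_zero.2 hv) hxv
  · exact isReducible_of_mulVec_ne_zero hv hxv (adjMatrix_eq_zero.2 hv ▸ hzv)

theorem isReducible_of_mem_neighbors {v w : V} {x : V → ZMod 2} (hw : w ∈ G.neighbors v)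
    (hxv : x v ≠ 0) (hxw : x w ≠ 0) : G.IsReducible x := by
  wlog hv : ¬ G.Edge v v generalizing G
  · refine (this (G := G.loopComplement v) ?_ ?_).of_loopComplement
    · rwa [neighbors_loopComplement]
    · rwa [loopComplement_edge_self]
  by_cases hzv : (G.adjMatrix *ᵥ x) v = 0
  swap
  · exact isReducible_of_mulVec_ne_zero hv hxv hzv
  by_cases hzw : (G.adjMatrix *ᵥ x) w = G.adjMatrix w w
  swap
  · exact isReducible_of_mulVec_ne_diag hxw hzw
  -- Complementing at `v` reverses the loop at `w` but preserves the word.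
  refine (isReducible_of_mulVec_ne_diag hxw ?_).of_nonSimpleLocalComplement hv hzv
  have hwv : G.adjMatrix w v ≠ 0 := adjMatrix_ne_zero.2 (G.symm _ _ hw.2)
  rw [nonSimpleLocalComplement_mulVec G hv, hzv, zero_smul, add_zero, hzw,
    adjMatrix_nonSimpleLocalComplement G hv, Matrix.add_apply, vecMulVec_apply, ne_eq, left_eq_add]
  exact mul_ne_zero hwv hwv

theorem isReducible_of_mem_neighbors_of_notMem_wordSupport {u v : V} {x : V → ZMod 2}
    (hu : u ∈ G.neighbors v) (hxv : x v ≠ 0) (hux : u ∉ wordSupport G.adjMatrix x) :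
    G.IsReducible x := by
  wlog huu : ¬ G.Edge u u generalizing G
  · refine (this (G := G.loopComplement u) ?_ ?_ ?_).of_loopComplement
    · rwa [neighbors_loopComplement]
    · rwa [wordSupport_loopComplement]
    · rwa [loopComplement_edge_self]
  obtain ⟨hxu, hzu⟩ := notMem_wordSupport.1 hux
  have hvu : v ∈ G.neighbors u := ⟨hu.1.symm, G.symm _ _ hu.2⟩
  obtain ⟨w, hwv, hw⟩ : ∃ w ≠ v, G.adjMatrix u w * x w ≠ 0 := by
    by_contra! hzero
    refine mul_ne_zero (adjMatrix_ne_zero.2 hvu.2) hxv ?_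
    rw [← hzu, mulVec, dotProduct, sum_eq_single v (fun w _ => hzero w) (by simp)]
  have hxw : x w ≠ 0 := right_ne_zero_of_mul hw
  have hwu : w ∈ G.neighbors u :=
    ⟨fun h => hxw (h ▸ hxu), adjMatrix_ne_zero.1 (left_ne_zero_of_mul hw)⟩
  by_cases hvw : G.Edge v w
  · exact isReducible_of_mem_neighbors ⟨hwv, hvw⟩ hxv hxw
  -- Otherwise complementing at `u` joins `v` to `w` and preserves the word.
  refine (isReducible_of_mem_neighbors ⟨hwv, ?_⟩ hxv hxw).of_nonSimpleLocalComplement huu hzu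
  exact (nonSimpleLocalComplement_edge G).2 (.inr ⟨⟨hvu, hwu⟩, hvw⟩)

theorem exists_locallyEquivalent_insert_neighbors_subset {x : V → ZMod 2} (hx : x ≠ 0) :
    ∃ H v, G.LocallyEquivalent H ∧
      insert v (H.neighbors v) ⊆ (wordSupport G.adjMatrix x : Set V) := by
  induction hk : #{v | x v ≠ 0} using Nat.strong_induction_on generalizing G x with
  | _ k ih =>
    by_cases hred : G.IsReducible x
    · obtain ⟨H, y, hGH, hsupp, hlt⟩ := hred
      have hy : y ≠ 0 := by rwa [← wordSupport_nonempty, hsupp, wordSupport_nonempty]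
      obtain ⟨K, v, hHK, hv⟩ := ih _ (hk ▸ hlt) hy rfl
      exact ⟨K, v, hGH.trans hHK, hsupp ▸ hv⟩
    · obtain ⟨v, hxv⟩ := Function.ne_iff.1 hx
      refine ⟨G, v, .refl, Set.insert_subset ?_ fun u hu => ?_⟩
      · by_contra hv
        exact hxv (notMem_wordSupport.1 hv).1
      · by_contra hux
        exact hred (isReducible_of_mem_neighbors_of_notMem_wordSupport hu hxv hux)

theorem exists_locallyEquivalent_degree_lt (G : LoopedGraph V) {x : V → ZMod 2} (hx : x ≠ 0) :
    ∃ H, G.LocallyEquivalent H ∧ ∃ v, H.degree v < #(wordSupport G.adjMatrix x) := by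
  obtain ⟨H, v, hGH, hsub⟩ := G.exists_locallyEquivalent_insert_neighbors_subset hx
  have hcard : (H.neighbors v).ncard < #(wordSupport G.adjMatrix x) := by
    have h := Set.ncard_le_ncard hsub (Set.toFinite _)
    rwa [Set.ncard_insert_of_notMem (fun hv => hv.1 rfl), Set.ncard_coe_finset] at h
  by_cases hv : H.Edge v v
  · refine ⟨H.loopComplement v, hGH.tail (.loop v), v, ?_⟩
    rwa [degree, neighbors_loopComplement, if_neg (by rwa [loopComplement_edge_self, not_not])]
  · exact ⟨H, hGH, v, by rwa [degree, if_neg hv]⟩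

end LocalEquivalence

end LoopedGraph

theorem corollary6_general {V : Type*} [Fintype V] (G : LoopedGraph V)
    (hn : Fintype.card V = 4 ∨ 7 ≤ Fintype.card V) :
    (∃ H : LoopedGraph V, G.LocallyEquivalent H ∧
      ∃ v : V, (H.degree v : ℝ) < ((Fintype.card V : ℝ) - 1) / 2) ∧
    ¬ G.isotropicMatroid.IsVerticallyConnected (Fintype.card V) ∧
    (∃ C : Set (LoopedGraph.Column V), G.IsTransverseCircuit C ∧
      (C.ncard : ℝ) ≤ (Fintype.card V : ℝ) / 2) := by
  obtain ⟨x, hx, hlight⟩ := exists_two_mul_card_wordSupport_le G.adjMatrix_isSymm hn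
  refine ⟨?_, G.not_isVerticallyConnected_of_two_mul_card_wordSupport_le hx hlight, ?_⟩
  · obtain ⟨H, hGH, v, hv⟩ := G.exists_locallyEquivalent_degree_lt hx
    have hdeg : 2 * (H.degree v : ℝ) + 1 < Fintype.card V := by
      exact_mod_cast (by omega : 2 * H.degree v + 1 < Fintype.card V)
    exact ⟨H, hGH, v, by linarith⟩
  · obtain ⟨C, hC, hcard⟩ := G.exists_isTransverseCircuit_ncard_le hx
    have hsize : 2 * (C.ncard : ℝ) ≤ Fintype.card V := by
      exact_mod_cast (by omega : 2 * C.ncard ≤ Fintype.card V)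
    exact ⟨C, hC, by linarith⟩

theorem corollary6 {V : Type*} [Fintype V] (G : LoopedGraph V) (hn : 7 ≤ Fintype.card V) :
    (∃ H : LoopedGraph V, G.LocallyEquivalent H ∧
      ∃ v : V, (H.degree v : ℝ) < ((Fintype.card V : ℝ) - 1) / 2) ∧
    ¬ G.isotropicMatroid.IsVerticallyConnected (Fintype.card V) ∧
    (∃ C : Set (LoopedGraph.Column V), G.IsTransverseCircuit C ∧
      (C.ncard : ℝ) ≤ (Fintype.card V : ℝ) / 2) :=
  corollary6_general G (.inr hn)
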